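/- For positive integers $\ell_1\le\ell_2\le\ell_3\le\ell_4$, let $S_{\ell_1,\ell_2,\ell_3,\ell_4}$ be the spider graph consisting of a central vertex $x_0$ and four paths (legs) with $\ell_1,\ell_2,\ell_3,\ell_4$ edges respectively, each starting at $x_0$ and pairwise having only $x_0$ in common. For a finite simple graph $G$, the edge-distinguishing chromatic number (EDCN) $\lambda(G)$ is the minimum integer $k$ for which there is a vertex coloring $c:V(G)\to\{1,\dots,k\}$ (not necessarily proper) such that the induced labels $\{c(u),c(v)\}$ of the edges $uv\in E(G)$ are pairwise distinct. Theorem. Let $\ell_1\le\ell_2\le\ell_3\le\ell_4$ be positive integers. Then $S_{\ell_1,\ell_2,\ell_3,\ell_4}$ has $e=\ell_1+\ell_2+\ell_3+\ell_4$ edges, and its EDCN is as follows. If $\ell_3=1$ (so that $\ell_1=\ell_2=\ell_3=1$), then $$\lambda(S_{1,1,1,\ell_4})=\begin{cases} 4 & \text{if } e\le 10;\\ \left\lceil\frac{-1+\sqrt{8e+9}}{2}\right\rceil & \text{if } e\ge 11 \text{ and } \left\lceil\frac{-1+\sqrt{8e+9}}{2}\right\rceil \text{ is odd};\\ \left\lceil\sqrt{2e-4}\right\rceil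 & \text{otherwise.} \end{cases}$$ If $\ell_3\ge 2$, then $$\lambda(S_{\ell_1,\ell_2,\ell_3,\ell_4})=\begin{cases} 4 & \text{if } e\le 10 \text{ and } \ell_1=1;\\ 5 & \text{if } e\le 10 \text{ and } \ell_1=2;\\ \left\lceil\frac{-1+\sqrt{8e+1}}{2}\right\rceil & \text{if } e\ge 11 \text{ and } \left\lceil\frac{-1+\sqrt{8e+1}}{2}\right\rceil \text{ is odd};\\ \left\lceil\sqrt{2e-4}\right\rceil & \text{otherwise.} \end{cases}$$ -/

import Mathlib

/-- A vertex coloring `c` is edge-distinguishing if the induced edge coloring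
`uv ↦ {c u, c v}` is injective on the edges of `G`. The unordered pair `{c u, c v}`, possibly with
`c u = c v`, is an element of `Sym2 α`. -/
def SimpleGraph.IsEdgeDistinguishing {V α : Type*} (G : SimpleGraph V) (c : V → α) : Prop :=
  Set.InjOn (Sym2.map c) G.edgeSet

/-- The edge-distinguishing chromatic number: the least `k` for which there is an
edge-distinguishing vertex coloring with `k` colors. -/
noncomputable def SimpleGraph.edcn {V : Type*} (G : SimpleGraph V) : ℕ :=
  sInf {k : ℕ | ∃ c : V → Fin k, G.IsEdgeDistinguishing c}

/-- For a finite graph the minimum defining `edcn` is attained. -/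
theorem SimpleGraph.isLeast_edcn {V : Type*} [Finite V] (G : SimpleGraph V) :
    IsLeast {k : ℕ | ∃ c : V → Fin k, G.IsEdgeDistinguishing c} G.edcn := by
  have hne : {k : ℕ | ∃ c : V → Fin k, G.IsEdgeDistinguishing c}.Nonempty :=
    ⟨Nat.card V, Finite.equivFin V,
      (Sym2.map.injective (Finite.equivFin V).injective).injOn⟩
  exact ⟨Nat.sInf_mem hne, fun _ hk => Nat.sInf_le hk⟩

/-- The vertices of the spider with leg lengths `ℓ`: the central vertex is `none`, and
`some ⟨i, j⟩` is the vertex of the `i`-th leg at distance `j + 1` from the central vertex. -/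
abbrev SpiderVertex {Δ : ℕ} (ℓ : Fin Δ → ℕ) : Type :=
  Option (Σ i : Fin Δ, Fin (ℓ i))

/-- `SpiderStep u v`: the vertex `v` comes immediately after `u` on some leg, when this leg is
traversed starting from the central vertex. -/
def SpiderStep {Δ : ℕ} {ℓ : Fin Δ → ℕ} : SpiderVertex ℓ → SpiderVertex ℓ → Prop
  | none, some y => (y.2 : ℕ) = 0
  | some x, some y => x.1 = y.1 ∧ (y.2 : ℕ) = (x.2 : ℕ) + 1
  | _, none => False

/-- The spider graph whose `i`-th leg is a path with `ℓ i` edges starting at the central vertex. -/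
def spiderGraph {Δ : ℕ} (ℓ : Fin Δ → ℕ) : SimpleGraph (SpiderVertex ℓ) :=
  SimpleGraph.fromRel SpiderStep

/-!
An edge-distinguishing coloring of the spider with `k` colors is the same as four edge-disjoint
trails with the lengths of the legs and a common start vertex in the complete graph with loops on
`k` vertices (`exists_isEdgeDistinguishing_iff`). This graph has `k (k + 1) / 2` edges.

*Lower bounds.* Besides counting edges, parity matters. Four trails that start at the same vertex
use an odd number of edge ends exactly at those vertices where an odd number of them ends, so at no
more than four vertices. If `k` is even, all degrees are odd, every vertex where no trail ends has
an unused edge, and at least `(k - 4) / 2` edges are unused; this gives `2 e ≤ k ^ 2 + 4`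
(`SpiderColorable.two_mul_sum_le_of_even`). If `k` is odd and three legs have length `1`, these end
at different vertices, and not all edges can be used (`SpiderColorable.two_mul_add_le_of_odd`).

*Colorings.* The last leg may be prolonged, so it is enough to attain these bounds. For odd `k` the
graph is split into two closed trails at the vertex `0` of prescribed lengths
(`closedSplit_of_odd`), and each of them is cut into two legs. For even `k` the same is done for the
graph without a perfect matching (`closedSplit_of_even`), which has `k ^ 2 / 2` edges, and each
closed trail is cut at a vertex `z` where one of the two legs is prolonged by the matching edge at
`z`. Depending on which of the two legs is prolonged, `z` is one or the other end of a certain step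
of the closed trail, and this freedom ensures that the two matching edges are different
(`exists_ne_matchingEdge`). Both splittings are obtained by induction from `k` to `k + 2`: the edges
at the two new vertices, in the even case without the edge joining them, form a closed trail at `0`,
an ear, which is attached to one of the two closed trails. Spiders with too short legs for this,
like those with three legs of length `1`, are treated separately with a single closed trail. For
four colors there are seven explicit colorings (`spiderColorable_four`).
-/

/-! ### Trails in the complete graph with loops -/

/-- `IsTrail S u v`: in the complete graph with loops on `ℕ`, there is a trail from `u` to `v`
whose set of edges is exactly `S`; its length is `S.card`. -/
inductive IsTrail : Finset (Sym2 ℕ) → ℕ → ℕ → Prop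
  | nil (v : ℕ) : IsTrail ∅ v v
  | cons {S : Finset (Sym2 ℕ)} {u v w : ℕ} (h : s(u, v) ∉ S) (hS : IsTrail S v w) :
      IsTrail (insert s(u, v) S) u w

theorem IsTrail.single (u v : ℕ) : IsTrail {s(u, v)} u v := by
  simpa using IsTrail.cons (S := ∅) (u := u) (by simp) (IsTrail.nil v)

theorem IsTrail.append {S T : Finset (Sym2 ℕ)} {u v w : ℕ} (hS : IsTrail S u v)
    (hT : IsTrail T v w) (hd : Disjoint S T) : IsTrail (S ∪ T) u w := by
  induction hS with
  | nil v => simpa using hT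
  | @cons S u v w' h hS ih =>
    rw [Finset.disjoint_insert_left] at hd
    rw [Finset.insert_union]
    exact .cons (by simp [h, hd.1]) (ih hT hd.2)

theorem IsTrail.reverse {S : Finset (Sym2 ℕ)} {u v : ℕ} (hS : IsTrail S u v) :
    IsTrail S v u := by
  induction hS with
  | nil v => exact .nil v
  | @cons S u v w h hS ih =>
    have := ih.append (IsTrail.single v u) (by simpa [Sym2.eq_swap] using h)
    rwa [Finset.union_comm, Sym2.eq_swap, ← Finset.insert_eq] at this

/-- A trail can be cut after any number of steps. -/
theorem IsTrail.exists_split {S : Finset (Sym2 ℕ)} {u w : ℕ} (hS : IsTrail S u w) :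
    ∀ n ≤ S.card, ∃ v S₁ S₂, S = S₁ ∪ S₂ ∧ Disjoint S₁ S₂ ∧ S₁.card = n ∧
      IsTrail S₁ u v ∧ IsTrail S₂ v w := by
  induction hS with
  | nil v =>
    intro n hn
    exact ⟨v, ∅, ∅, by simp, by simp, by simp at hn; simp [hn], .nil v, .nil v⟩
  | @cons S u v w h hS ih =>
    intro n hn
    rcases n with _ | n
    · exact ⟨u, ∅, _, by simp, by simp, rfl, .nil u, .cons h hS⟩
    · rw [Finset.card_insert_of_notMem h] at hn
      obtain ⟨x, S₁, S₂, rfl, hd, hc, h₁, h₂⟩ := ih n (by omega)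
      rw [Finset.mem_union, not_or] at h
      exact ⟨x, insert s(u, v) S₁, S₂, by rw [Finset.insert_union],
        Finset.disjoint_insert_left.2 ⟨h.2, hd⟩, by rw [Finset.card_insert_of_notMem h.1, hc],
        .cons h.1 h₁, h₂⟩

theorem IsTrail.exists_first_step {S : Finset (Sym2 ℕ)} {u w : ℕ} (hS : IsTrail S u w)
    (hpos : 0 < S.card) :
    ∃ v T, s(u, v) ∉ T ∧ S = insert s(u, v) T ∧ IsTrail T v w := by
  cases hS with
  | nil => simp at hpos
  | @cons T _ v _ h hT => exact ⟨v, T, h, rfl, hT⟩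

/-- The sequence of vertices visited by a trail. -/
theorem IsTrail.exists_seq {S : Finset (Sym2 ℕ)} {u v : ℕ} (hS : IsTrail S u v) :
    ∃ f : ℕ → ℕ, f 0 = u ∧ (∀ i < S.card, s(f i, f (i + 1)) ∈ S) ∧
      ∀ i < S.card, ∀ j < S.card, s(f i, f (i + 1)) = s(f j, f (j + 1)) → i = j := by
  induction hS with
  | nil v => exact ⟨fun _ => v, rfl, by simp, by simp⟩
  | @cons S u v w h hS ih =>
    obtain ⟨f, h0, hm, hi⟩ := ih
    rw [Finset.card_insert_of_notMem h]
    refine ⟨fun i => Nat.casesOn i u f, rfl, ?_, ?_⟩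
    · rintro (_ | i) hlt
      · simp [h0]
      · exact Finset.mem_insert_of_mem (hm i (by omega))
    · rintro (_ | i) hlt (_ | j) hlt' heq
      · rfl
      · have := hm j (by omega)
        rw [← heq, zero_add] at this
        exact absurd (h0 ▸ this) h
      · have := hm i (by omega)
        rw [heq, zero_add] at this
        exact absurd (h0 ▸ this) h
      · rw [hi i (by omega) j (by omega) heq]

/-- The edges traversed by the walk with the given list of vertices. -/
def walkEdges : List ℕ → List (Sym2 ℕ)
  | a :: b :: l => s(a, b) :: walkEdges (b :: l)
  | _ => []

theorem IsTrail.of_walkEdges : ∀ (l : List ℕ) (a : ℕ), (walkEdges (a :: l)).Nodup →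
    IsTrail (walkEdges (a :: l)).toFinset a (l.getLastD a)
  | [], a, _ => by simpa [walkEdges] using IsTrail.nil a
  | b :: l, a, h => by
    rw [walkEdges, List.nodup_cons] at h
    rw [walkEdges, List.toFinset_cons, List.getLastD_cons]
    exact .cons (by simpa using h.1) (IsTrail.of_walkEdges l b h.2)

theorem walkEdges_length : ∀ (l : List ℕ) (a : ℕ), (walkEdges (a :: l)).length = l.length
  | [], _ => rfl
  | b :: l, a => by rw [walkEdges, List.length_cons, walkEdges_length l b, List.length_cons]

theorem mem_of_mem_walkEdges :
    ∀ {l : List ℕ} {e : Sym2 ℕ} {x : ℕ}, e ∈ walkEdges l → x ∈ e → x ∈ l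
  | a :: b :: l, e, x, he, hx => by
    rw [walkEdges, List.mem_cons] at he
    rcases he with rfl | he
    · rcases Sym2.mem_iff.1 hx with rfl | rfl <;> simp
    · exact List.mem_cons_of_mem _ (mem_of_mem_walkEdges he hx)
  | [_], e, x, he, _ => by simp [walkEdges] at he
  | [], e, x, he, _ => by simp [walkEdges] at he

theorem card_walkEdges {l : List ℕ} {a : ℕ} (h : (walkEdges (a :: l)).Nodup) :
    (walkEdges (a :: l)).toFinset.card = l.length := by
  rw [List.toFinset_card_of_nodup h, walkEdges_length]

/-! ### Ears -/

/-- The `n` four-cycles `u, x, w, x + 1` with `x = s, s + 2, …`, all of them inserted at `u`. -/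
theorem exists_trail_fourCycles {u w s : ℕ} (huw : u ≠ w) (n : ℕ) (hu : s + 2 * n ≤ u)
    (hw : s + 2 * n ≤ w) : ∃ C : Finset (Sym2 ℕ), C.card = 4 * n ∧ IsTrail C u u ∧
      ∀ e ∈ C, ∃ x, s ≤ x ∧ x < s + 2 * n ∧ (e = s(u, x) ∨ e = s(w, x)) := by
  induction n with
  | zero => exact ⟨∅, rfl, .nil u, by simp⟩
  | succ n ih =>
    obtain ⟨C, hc, ht, hm⟩ := ih (by omega) (by omega)
    have hnd : (walkEdges (u :: [s + 2 * n, w, s + 2 * n + 1, u])).Nodup := by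
      clear ih hm
      simp [walkEdges]
      omega
    have hcyc := IsTrail.of_walkEdges _ _ hnd
    have hd : Disjoint C (walkEdges (u :: [s + 2 * n, w, s + 2 * n + 1, u])).toFinset := by
      rw [Finset.disjoint_left]
      intro e he he'
      obtain ⟨x, h1, h2, h3⟩ := hm e he
      rcases h3 with rfl | rfl <;> simp [walkEdges] at he' <;> omega
    refine ⟨_, ?_, ht.append hcyc hd, ?_⟩
    · rw [Finset.card_union_of_disjoint hd, hc, card_walkEdges hnd]
      rfl
    · intro e he
      rw [Finset.mem_union] at he
      rcases he with he | he
      · obtain ⟨x, h1, h2, h3⟩ := hm e he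
        exact ⟨x, h1, by omega, h3⟩
      · simp only [walkEdges, List.toFinset_cons, List.toFinset_nil, Finset.mem_insert,
          insert_empty_eq, Finset.mem_singleton] at he
        rcases he with rfl | rfl | rfl | rfl
        · exact ⟨s + 2 * n, by omega, by omega, .inl rfl⟩
        · exact ⟨s + 2 * n, by omega, by omega, .inr Sym2.eq_swap⟩
        · exact ⟨s + 2 * n + 1, by omega, by omega, .inr rfl⟩
        · exact ⟨s + 2 * n + 1, by omega, by omega, .inl Sym2.eq_swap⟩

/-- `IsEar k C`: the edges `C` form a closed trail at `0` in the complete graph with loops on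
`0, …, k + 1`, and each of them contains one of the vertices `k`, `k + 1`. -/
structure IsEar (k : ℕ) (C : Finset (Sym2 ℕ)) : Prop where
  trail : IsTrail C 0 0
  subset : C ⊆ (Finset.range (k + 2)).sym2
  new : ∀ e ∈ C, k ∈ e ∨ k + 1 ∈ e

theorem IsEar.disjoint {k : ℕ} {C S : Finset (Sym2 ℕ)} (hC : IsEar k C)
    (hS : S ⊆ (Finset.range k).sym2) : Disjoint S C := by
  rw [Finset.disjoint_left]
  intro e he he'
  have h := Finset.mem_sym2_iff.1 (hS he)
  rcases hC.new e he' with h' | h' <;> simpa using h _ h'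

/-- The ear that takes the complete graph with loops on `k` vertices, `k` odd, to the one on
`k + 2` vertices: it contains all edges at the two new vertices. -/
theorem exists_isEar_of_odd {k : ℕ} (hk : Odd k) :
    ∃ C, IsEar k C ∧ C.card = 2 * k + 3 := by
  obtain ⟨m, rfl⟩ := hk
  obtain ⟨C, hc, ht, hm⟩ := exists_trail_fourCycles (u := 2 * m + 1) (w := 2 * m + 2) (s := 1)
    (by omega) m (by omega) (by omega)
  have hnd : (walkEdges ((2 * m + 1) :: [2 * m + 1, 2 * m + 2, 2 * m + 2, 0])).Nodup := by
    simp [walkEdges]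
  have hd : Disjoint C
      (walkEdges ((2 * m + 1) :: [2 * m + 1, 2 * m + 2, 2 * m + 2, 0])).toFinset := by
    rw [Finset.disjoint_left]
    intro e he he'
    obtain ⟨x, h1, h2, h3⟩ := hm e he
    rcases h3 with rfl | rfl <;> simp [walkEdges] at he' <;> omega
  have hd' : s(0, 2 * m + 1) ∉
      C ∪ (walkEdges ((2 * m + 1) :: [2 * m + 1, 2 * m + 2, 2 * m + 2, 0])).toFinset := by
    intro he
    rw [Finset.mem_union] at he
    rcases he with he | he
    · obtain ⟨x, h1, h2, h3⟩ := hm _ he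
      simp at h3
      omega
    · simp [walkEdges] at he
  refine ⟨_, ⟨.cons hd' (ht.append (IsTrail.of_walkEdges _ _ hnd) hd), ?_, ?_⟩, ?_⟩
  · intro e he
    rw [Finset.mem_insert, Finset.mem_union] at he
    rcases he with rfl | he | he
    · simp
    · obtain ⟨x, h1, h2, rfl | rfl⟩ := hm _ he <;> simp <;> omega
    · simp [walkEdges] at he
      rcases he with rfl | rfl | rfl | rfl <;> simp
  · intro e he
    rw [Finset.mem_insert, Finset.mem_union] at he
    rcases he with rfl | he | he
    · simp
    · obtain ⟨x, h1, h2, rfl | rfl⟩ := hm _ he <;> simp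
    · simp [walkEdges] at he
      rcases he with rfl | rfl | rfl | rfl <;> simp
  · rw [Finset.card_insert_of_notMem hd', Finset.card_union_of_disjoint hd, hc, card_walkEdges hnd]
    simp
    omega

/-- The partner of a vertex in the perfect matching `{0, 1}, {2, 3}, …`. -/
def mate (x : ℕ) : ℕ := if x % 2 = 0 then x + 1 else x - 1

theorem mate_mate (x : ℕ) : mate (mate x) = x := by
  unfold mate
  split_ifs <;> omega

/-- `MateBalanced S`: no edge of the perfect matching given by `mate` is in `S`, and the loops at
two partners are in `S` or not in `S` together. -/
def MateBalanced (S : Finset (Sym2 ℕ)) : Prop :=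
  ∀ x, s(x, mate x) ∉ S ∧ (s(x, x) ∈ S → s(mate x, mate x) ∈ S)

theorem MateBalanced.union {S T : Finset (Sym2 ℕ)} (hS : MateBalanced S) (hT : MateBalanced T) :
    MateBalanced (S ∪ T) := fun x => by
  have := hS x
  have := hT x
  simp only [Finset.mem_union]
  tauto

/-- The ear for an even number `k` of vertices: it contains all edges at the two new vertices
except the one that joins them. -/
theorem exists_isEar_of_even {k : ℕ} (hk : Even k) (h2 : 2 ≤ k) :
    ∃ C, IsEar k C ∧ C.card = 2 * k + 2 ∧ MateBalanced C := by
  obtain ⟨m, rfl⟩ : ∃ m, k = 2 * m + 2 := ⟨k / 2 - 1, by obtain ⟨r, rfl⟩ := hk; omega⟩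
  obtain ⟨C, hc, ht, hm⟩ := exists_trail_fourCycles (u := 2 * m + 2) (w := 2 * m + 3) (s := 2)
    (by omega) m (by omega) (by omega)
  have hnd : (walkEdges ((2 * m + 2) :: [2 * m + 2, 1, 2 * m + 3, 2 * m + 3, 0])).Nodup := by
    simp [walkEdges]
  have hd : Disjoint C
      (walkEdges ((2 * m + 2) :: [2 * m + 2, 1, 2 * m + 3, 2 * m + 3, 0])).toFinset := by
    rw [Finset.disjoint_left]
    intro e he he'
    obtain ⟨x, h1, h2, h3⟩ := hm e he
    rcases h3 with rfl | rfl <;> simp [walkEdges] at he' <;> omega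
  have hd' : s(0, 2 * m + 2) ∉
      C ∪ (walkEdges ((2 * m + 2) :: [2 * m + 2, 1, 2 * m + 3, 2 * m + 3, 0])).toFinset := by
    intro he
    rw [Finset.mem_union] at he
    rcases he with he | he
    · obtain ⟨x, h1, h2, h3⟩ := hm _ he
      simp at h3
      omega
    · simp [walkEdges] at he
  refine ⟨_, ⟨.cons hd' (ht.append (IsTrail.of_walkEdges _ _ hnd) hd), ?_, ?_⟩, ?_, ?_⟩
  · intro e he
    rw [Finset.mem_insert, Finset.mem_union] at he
    rcases he with rfl | he | he
    · simp
    · obtain ⟨x, h1, h2, rfl | rfl⟩ := hm _ he <;> simp <;> omega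
    · simp [walkEdges] at he
      rcases he with rfl | rfl | rfl | rfl | rfl <;> simp
  · intro e he
    rw [Finset.mem_insert, Finset.mem_union] at he
    rcases he with rfl | he | he
    · simp
    · obtain ⟨x, h1, h2, rfl | rfl⟩ := hm _ he <;> simp
    · simp [walkEdges] at he
      rcases he with rfl | rfl | rfl | rfl | rfl <;> simp
  · rw [Finset.card_insert_of_notMem hd', Finset.card_union_of_disjoint hd, hc, card_walkEdges hnd]
    simp
    omega
  · have hmate : mate (2 * m + 2) = 2 * m + 3 ∧ mate (2 * m + 3) = 2 * m + 2 := by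
      unfold mate
      constructor <;> split_ifs <;> omega
    intro x
    simp only [Finset.mem_insert, Finset.mem_union]
    refine ⟨?_, ?_⟩
    · rintro (he | he | he)
      · unfold mate at he
        simp at he
        split_ifs at he <;> grind
      · obtain ⟨y, h1, h2, he | he⟩ := hm _ he <;> unfold mate at he <;> simp at he <;>
          split_ifs at he <;> omega
      · unfold mate at he
        simp [walkEdges] at he
        split_ifs at he <;> omega
    · rintro (he | he | he)
      · simp at he
        omega
      · obtain ⟨y, h1, h2, he | he⟩ := hm _ he <;> simp at he <;> omega
      · right; right
        simp [walkEdges] at he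
        rcases he with rfl | h | h | rfl | h
        all_goals first | omega | simp [walkEdges, hmate]

/-! ### Splitting a graph into two closed trails -/

/-- `ClosedSplit P k a b`: in the complete graph with loops on `0, …, k - 1` there are two
edge-disjoint closed trails at `0`, of lengths `a` and `b`, both of whose edge sets satisfy `P`. -/
def ClosedSplit (P : Finset (Sym2 ℕ) → Prop) (k a b : ℕ) : Prop :=
  ∃ A B : Finset (Sym2 ℕ), IsTrail A 0 0 ∧ IsTrail B 0 0 ∧ Disjoint A B ∧
    A ⊆ (Finset.range k).sym2 ∧ B ⊆ (Finset.range k).sym2 ∧ A.card = a ∧ B.card = b ∧ P A ∧ P B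

theorem ClosedSplit.symm {P : Finset (Sym2 ℕ) → Prop} {k a b : ℕ} (h : ClosedSplit P k a b) :
    ClosedSplit P k b a := by
  obtain ⟨A, B, h1, h2, h3, h4, h5, h6, h7, h8, h9⟩ := h
  exact ⟨B, A, h2, h1, h3.symm, h5, h4, h7, h6, h9, h8⟩

theorem range_sym2_subset {k l : ℕ} (h : k ≤ l) :
    (Finset.range k).sym2 ⊆ (Finset.range l).sym2 :=
  Finset.sym2_mono (Finset.range_mono h)

/-- An ear can be added to the second trail. -/
theorem ClosedSplit.add_ear {P : Finset (Sym2 ℕ) → Prop}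
    (hP : ∀ S T, P S → P T → P (S ∪ T)) {k a b : ℕ} (h : ClosedSplit P k a b)
    {C : Finset (Sym2 ℕ)} (hC : IsEar k C) (hPC : P C) :
    ClosedSplit P (k + 2) a (b + C.card) := by
  obtain ⟨A, B, h1, h2, h3, h4, h5, h6, h7, h8, h9⟩ := h
  have hk : k ≤ k + 2 := by omega
  refine ⟨A, B ∪ C, h1, h2.append hC.trail (hC.disjoint h5),
    Finset.disjoint_union_right.2 ⟨h3, hC.disjoint h4⟩, h4.trans (range_sym2_subset hk),
    Finset.union_subset (h5.trans (range_sym2_subset hk)) hC.subset, h6, ?_, h8, hP _ _ h9 hPC⟩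
  rw [Finset.card_union_of_disjoint (hC.disjoint h5), h7]

theorem walkEdges_subset {l : List ℕ} {k : ℕ} (h : ∀ x ∈ l, x < k) :
    (walkEdges l).toFinset ⊆ (Finset.range k).sym2 := by
  intro e he
  rw [Finset.mem_sym2_iff]
  intro x hx
  exact Finset.mem_range.2 (h x (mem_of_mem_walkEdges (List.mem_toFinset.1 he) hx))

theorem ClosedSplit.of_walks {P : Finset (Sym2 ℕ) → Prop} (k : ℕ) (l m : List ℕ)
    (hnd : (walkEdges (0 :: l) ++ walkEdges (0 :: m)).Nodup)
    (hk : ∀ x ∈ (0 :: l) ++ (0 :: m), x < k) (hl : l.getLastD 0 = 0) (hm : m.getLastD 0 = 0)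
    (hPl : P (walkEdges (0 :: l)).toFinset) (hPm : P (walkEdges (0 :: m)).toFinset) :
    ClosedSplit P k l.length m.length := by
  rw [List.nodup_append'] at hnd
  obtain ⟨h1, h2, h3⟩ := hnd
  have hA := IsTrail.of_walkEdges l 0 h1
  have hB := IsTrail.of_walkEdges m 0 h2
  rw [hl] at hA
  rw [hm] at hB
  refine ⟨_, _, hA, hB, ?_,
    walkEdges_subset fun x hx => hk x (List.mem_append_left _ hx),
    walkEdges_subset fun x hx => hk x (List.mem_append_right _ hx),
    card_walkEdges h1, card_walkEdges h2, hPl, hPm⟩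
  rw [Finset.disjoint_left]
  intro e he he'
  exact h3 (List.mem_toFinset.1 he) (List.mem_toFinset.1 he')

theorem MateBalanced.of_walk {k : ℕ} {l : List ℕ} (hk : ∀ x ∈ l, x < k)
    (h : ∀ x < k, s(x, mate x) ∉ walkEdges l ∧
      (s(x, x) ∈ walkEdges l → s(mate x, mate x) ∈ walkEdges l)) :
    MateBalanced (walkEdges l).toFinset := fun x => by
  simp only [List.mem_toFinset]
  by_cases hx : x < k
  · exact h x hx
  · exact ⟨fun h' => hx (hk x (mem_of_mem_walkEdges h' (Sym2.mem_mk_left _ _))),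
      fun h' => absurd (hk x (mem_of_mem_walkEdges h' (Sym2.mem_mk_left _ _))) hx⟩

theorem closedSplit_five {a b : ℕ} (ha : 3 ≤ a) (h : a ≤ b) (hab : a + b = 15) :
    ClosedSplit (fun _ => True) 5 a b := by
  obtain rfl : b = 15 - a := by omega
  have ha' : a ≤ 7 := by omega
  clear h hab
  interval_cases a
  · exact ClosedSplit.of_walks 5 [3, 4, 0]
      [0, 1, 3, 3, 2, 2, 1, 1, 4, 4, 2, 0] (by decide) (by decide) rfl rfl trivial trivial
  · exact ClosedSplit.of_walks 5 [3, 2, 2, 0]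
      [0, 1, 1, 4, 4, 3, 3, 1, 2, 4, 0] (by decide) (by decide) rfl rfl trivial trivial
  · exact ClosedSplit.of_walks 5 [2, 4, 4, 3, 0]
      [0, 4, 1, 1, 3, 3, 2, 2, 1, 0] (by decide) (by decide) rfl rfl trivial trivial
  · exact ClosedSplit.of_walks 5 [1, 4, 3, 3, 2, 0]
      [0, 4, 4, 2, 2, 1, 1, 3, 0] (by decide) (by decide) rfl rfl trivial trivial
  · exact ClosedSplit.of_walks 5 [2, 1, 4, 2, 2, 3, 0]
      [0, 4, 4, 3, 3, 1, 1, 0] (by decide) (by decide) rfl rfl trivial trivial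

theorem closedSplit_seven {a b : ℕ} (ha : 13 ≤ a) (h : a ≤ b) (hab : a + b = 28) :
    ClosedSplit (fun _ => True) 7 a b := by
  obtain rfl : b = 28 - a := by omega
  have ha' : a ≤ 14 := by omega
  clear h hab
  interval_cases a
  · exact ClosedSplit.of_walks 7 [0, 5, 5, 6, 4, 2, 3, 5, 1, 1, 2, 2, 0]
      [3, 3, 4, 4, 5, 2, 6, 6, 3, 1, 0, 6, 1, 4, 0] (by decide) (by decide) rfl rfl trivial trivial
  · exact ClosedSplit.of_walks 7 [0, 2, 2, 4, 5, 1, 6, 3, 5, 5, 2, 6, 5, 0]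
      [1, 3, 3, 2, 1, 1, 4, 4, 3, 0, 4, 6, 6, 0] (by decide) (by decide) rfl rfl trivial trivial

/-- For odd `k ≥ 5` the complete graph with loops on `k` vertices splits into two closed trails at
`0` of any prescribed lengths that are at least `3`. -/
theorem closedSplit_of_odd {k : ℕ} (hk : Odd k) (h5 : 5 ≤ k) :
    ∀ {a b : ℕ}, 3 ≤ a → a ≤ b → 2 * (a + b) = k * (k + 1) →
      ClosedSplit (fun _ => True) k a b := by
  obtain ⟨n, rfl⟩ : ∃ n, k = 2 * n + 5 := ⟨(k - 5) / 2, by obtain ⟨r, rfl⟩ := hk; omega⟩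
  clear hk h5
  induction n with
  | zero =>
    intro a b ha h hab
    exact closedSplit_five ha h (by omega)
  | succ n ih =>
    intro a b ha h hab
    obtain ⟨C, hC, hcard⟩ := exists_isEar_of_odd (k := 2 * n + 5) ⟨n + 2, by omega⟩
    have key : ∀ b', 2 * (a + b') = (2 * n + 5) * (2 * n + 5 + 1) → 3 ≤ b' →
        ClosedSplit (fun _ => True) (2 * n + 5 + 2) a b := by
      intro b' hb' h3
      have hsplit : ClosedSplit (fun _ => True) (2 * n + 5) a b' := by
        rcases le_total a b' with h' | h'
        · exact ih ha h' hb'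
        · exact (ih h3 h' (by omega)).symm
      have := hsplit.add_ear (fun _ _ _ _ => trivial) hC trivial
      have hb : b' + C.card = b := by rw [hcard]; nlinarith
      rwa [hb] at this
    -- Shortening the second trail by an ear leaves at least `3` edges, except on `7` vertices with
    -- `a = 13` or `a = 14`.
    rcases n with _ | n
    · by_cases h12 : a ≤ 12
      · exact key (15 - a) (by omega) (by omega)
      · exact closedSplit_seven (by omega) h (by omega)
    · have hbig : 2 * (a + 3) ≤ (2 * (n + 1) + 5) * (2 * (n + 1) + 5 + 1) := by nlinarith
      obtain ⟨t, ht⟩ : ∃ t, (2 * (n + 1) + 5) * (2 * (n + 1) + 5 + 1) = 2 * t :=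
        ⟨(2 * (n + 1) + 5) * (n + 4), by ring⟩
      exact key (t - a) (by omega) (by omega)

theorem closedSplit_mate_six {a b : ℕ} (ha : 3 ≤ a) (h : a ≤ b) (hab : a + b = 18) :
    ClosedSplit MateBalanced 6 a b := by
  obtain rfl : b = 18 - a := by omega
  have ha' : a ≤ 9 := by omega
  clear h hab
  interval_cases a
  · exact ClosedSplit.of_walks 6 [2, 4, 0]
      [3, 1, 1, 4, 4, 3, 3, 5, 5, 1, 2, 2, 5, 0, 0] (by decide) (by decide) rfl rfl
      (.of_walk (k := 6) (by decide) (by decide)) (.of_walk (k := 6) (by decide) (by decide))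
  · exact ClosedSplit.of_walks 6 [3, 1, 5, 0]
      [0, 4, 4, 3, 3, 5, 5, 2, 4, 1, 1, 2, 2, 0] (by decide) (by decide) rfl rfl
      (.of_walk (k := 6) (by decide) (by decide)) (.of_walk (k := 6) (by decide) (by decide))
  · exact ClosedSplit.of_walks 6 [2, 1, 3, 5, 0]
      [3, 3, 4, 1, 1, 5, 5, 2, 2, 4, 4, 0, 0] (by decide) (by decide) rfl rfl
      (.of_walk (k := 6) (by decide) (by decide)) (.of_walk (k := 6) (by decide) (by decide))
  · exact ClosedSplit.of_walks 6 [5, 5, 1, 4, 4, 0]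
      [0, 2, 5, 3, 3, 4, 2, 2, 1, 1, 3, 0] (by decide) (by decide) rfl rfl
      (.of_walk (k := 6) (by decide) (by decide)) (.of_walk (k := 6) (by decide) (by decide))
  · exact ClosedSplit.of_walks 6 [5, 2, 2, 1, 3, 3, 0]
      [0, 2, 4, 3, 5, 5, 1, 1, 4, 4, 0] (by decide) (by decide) rfl rfl
      (.of_walk (k := 6) (by decide) (by decide)) (.of_walk (k := 6) (by decide) (by decide))
  · exact ClosedSplit.of_walks 6 [3, 4, 4, 1, 5, 5, 2, 0]
      [0, 4, 2, 2, 1, 1, 3, 3, 5, 0] (by decide) (by decide) rfl rfl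
      (.of_walk (k := 6) (by decide) (by decide)) (.of_walk (k := 6) (by decide) (by decide))
  · exact ClosedSplit.of_walks 6 [3, 4, 1, 5, 5, 2, 4, 4, 0]
      [2, 2, 1, 1, 3, 3, 5, 0, 0] (by decide) (by decide) rfl rfl
      (.of_walk (k := 6) (by decide) (by decide)) (.of_walk (k := 6) (by decide) (by decide))

theorem closedSplit_mate_eight : ClosedSplit MateBalanced 8 16 16 :=
  ClosedSplit.of_walks 8 [2, 1, 5, 7, 1, 6, 4, 3, 1, 1, 4, 0, 5, 3, 0, 0]
      [7, 7, 4, 4, 2, 7, 3, 3, 6, 6, 5, 5, 2, 2, 6, 0] (by decide) (by decide) rfl rfl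
      (.of_walk (k := 8) (by decide) (by decide)) (.of_walk (k := 8) (by decide) (by decide))

/-- For even `k ≥ 6` the complete graph with loops on `k` vertices without the perfect matching
given by `mate` splits into two closed trails at `0` of any prescribed lengths that are at
least `3`, in such a way that the loops at partners are in the same trail. -/
theorem closedSplit_of_even {k : ℕ} (hk : Even k) (h6 : 6 ≤ k) :
    ∀ {a b : ℕ}, 3 ≤ a → a ≤ b → 2 * (a + b) = k * k → ClosedSplit MateBalanced k a b := by
  obtain ⟨n, rfl⟩ : ∃ n, k = 2 * n + 6 := ⟨(k - 6) / 2, by obtain ⟨r, rfl⟩ := hk; omega⟩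
  clear hk h6
  induction n with
  | zero =>
    intro a b ha h hab
    exact closedSplit_mate_six ha h (by omega)
  | succ n ih =>
    intro a b ha h hab
    obtain ⟨C, hC, hcard, hmate⟩ :=
      exists_isEar_of_even (k := 2 * n + 6) ⟨n + 3, by omega⟩ (by omega)
    have key : ∀ b', 2 * (a + b') = (2 * n + 6) * (2 * n + 6) → 3 ≤ b' →
        ClosedSplit MateBalanced (2 * n + 6 + 2) a b := by
      intro b' hb' h3
      have hsplit : ClosedSplit MateBalanced (2 * n + 6) a b' := by
        rcases le_total a b' with h' | h'
        · exact ih ha h' hb'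
        · exact (ih h3 h' (by omega)).symm
      have := hsplit.add_ear (fun _ _ => MateBalanced.union) hC hmate
      have hb : b' + C.card = b := by rw [hcard]; nlinarith
      rwa [hb] at this
    -- Shortening the second trail by an ear leaves at least `3` edges, except on `8` vertices with
    -- `a = 16`.
    rcases n with _ | n
    · by_cases h15 : a ≤ 15
      · exact key (18 - a) (by omega) (by omega)
      · obtain ⟨rfl, rfl⟩ : a = 16 ∧ b = 16 := by omega
        exact closedSplit_mate_eight
    · have hbig : 2 * (a + 3) ≤ (2 * (n + 1) + 6) * (2 * (n + 1) + 6) := by nlinarith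
      obtain ⟨t, ht⟩ : ∃ t, (2 * (n + 1) + 6) * (2 * (n + 1) + 6) = 2 * t :=
        ⟨(2 * (n + 1) + 6) * (n + 4), by ring⟩
      exact key (t - a) (by omega) (by omega)

/-- A closed trail that leaves three edges at `0` free, among them the loop. It uses all edges
except these three and the edge `{1, 2}`. -/
theorem exists_closedTrail_of_odd {k : ℕ} (hk : Odd k) (h5 : 5 ≤ k) :
    ∃ B, IsTrail B 0 0 ∧ B ⊆ (Finset.range k).sym2 ∧ 2 * (B.card + 4) = k * (k + 1) ∧
      s(0, 0) ∉ B ∧ s(0, 1) ∉ B ∧ s(0, 2) ∉ B := by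
  obtain ⟨n, rfl⟩ : ∃ n, k = 2 * n + 5 := ⟨(k - 5) / 2, by obtain ⟨r, rfl⟩ := hk; omega⟩
  clear hk h5
  induction n with
  | zero =>
    have hnd : (walkEdges (0 :: [4, 4, 3, 3, 2, 2, 4, 1, 1, 3, 0])).Nodup := by decide
    exact ⟨_, IsTrail.of_walkEdges _ _ hnd, walkEdges_subset (by decide),
      by rw [card_walkEdges hnd]; rfl, by decide, by decide, by decide⟩
  | succ n ih =>
    obtain ⟨B, h1, h2, h3, h4, h5, h6⟩ := ih
    obtain ⟨C, hC, hcard⟩ := exists_isEar_of_odd (k := 2 * n + 5) ⟨n + 2, by omega⟩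
    have hnew : ∀ x < 3, s(0, x) ∉ C := by
      intro x hx he
      rcases hC.new _ he with h | h <;> rw [Sym2.mem_iff] at h <;> omega
    refine ⟨B ∪ C, h1.append hC.trail (hC.disjoint h2),
      Finset.union_subset (h2.trans (range_sym2_subset (by omega))) hC.subset, ?_, ?_, ?_, ?_⟩
    · rw [Finset.card_union_of_disjoint (hC.disjoint h2), hcard]
      nlinarith
    all_goals rw [Finset.mem_union, not_or]
    exacts [⟨h4, hnew 0 (by omega)⟩, ⟨h5, hnew 1 (by omega)⟩, ⟨h6, hnew 2 (by omega)⟩]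

/-- A closed trail that uses all edges except the loop at `0` and the perfect matching given by
`mate`. -/
theorem exists_closedTrail_of_even {k : ℕ} (hk : Even k) (h6 : 6 ≤ k) :
    ∃ B, IsTrail B 0 0 ∧ B ⊆ (Finset.range k).sym2 ∧ 2 * (B.card + 1) = k * k ∧
      s(0, 0) ∉ B ∧ ∀ x, s(x, mate x) ∉ B := by
  obtain ⟨n, rfl⟩ : ∃ n, k = 2 * n + 6 := ⟨(k - 6) / 2, by obtain ⟨r, rfl⟩ := hk; omega⟩
  clear hk h6
  induction n with
  | zero =>
    have hnd : (walkEdges (0 :: [3, 3, 4, 4, 2, 2, 5, 3, 1, 1, 5, 5, 0, 2, 1, 4, 0])).Nodup := by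
      decide
    have hlt : ∀ x ∈ (0 :: [3, 3, 4, 4, 2, 2, 5, 3, 1, 1, 5, 5, 0, 2, 1, 4, 0]), x < 6 := by decide
    refine ⟨_, IsTrail.of_walkEdges _ _ hnd, walkEdges_subset hlt,
      by rw [card_walkEdges hnd]; rfl, by decide, fun x he => ?_⟩
    have h' := List.mem_toFinset.1 he
    have hx : x < 6 := hlt x (mem_of_mem_walkEdges h' (Sym2.mem_mk_left _ _))
    revert h'
    clear he
    decide +revert
  | succ n ih =>
    obtain ⟨B, h1, h2, h3, h4, h5⟩ := ih
    obtain ⟨C, hC, hcard, hmate⟩ :=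
      exists_isEar_of_even (k := 2 * n + 6) ⟨n + 3, by omega⟩ (by omega)
    refine ⟨B ∪ C, h1.append hC.trail (hC.disjoint h2),
      Finset.union_subset (h2.trans (range_sym2_subset (by omega))) hC.subset, ?_, ?_, ?_⟩
    · rw [Finset.card_union_of_disjoint (hC.disjoint h2), hcard]
      nlinarith
    · rw [Finset.mem_union, not_or]
      refine ⟨h4, fun he => ?_⟩
      rcases hC.new _ he with h | h <;> rw [Sym2.mem_iff] at h <;> omega
    · intro x
      rw [Finset.mem_union, not_or]
      exact ⟨h5 x, (hmate x).1⟩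

/-! ### The edges of a spider -/

section Spider

variable {Δ : ℕ} {ℓ : Fin Δ → ℕ}

/-- The neighbor of a vertex on a leg in the direction of the central vertex. -/
def spiderParent (y : Σ i : Fin Δ, Fin (ℓ i)) : SpiderVertex ℓ :=
  if (y.2 : ℕ) = 0 then none else some ⟨y.1, ⟨y.2 - 1, by omega⟩⟩

/-- The edge from a vertex on a leg towards the central vertex. Every edge of the spider has this
form for exactly one vertex. -/
def spiderEdge (y : Σ i : Fin Δ, Fin (ℓ i)) : Sym2 (SpiderVertex ℓ) :=
  s(spiderParent y, some y)

theorem spiderStep_iff {u v : SpiderVertex ℓ} :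
    SpiderStep u v ↔ ∃ y, u = spiderParent y ∧ v = some y := by
  rcases v with _ | y
  · rcases u with _ | x <;> simp [SpiderStep]
  · have hex : (∃ y', u = spiderParent y' ∧ some y = some y') ↔ u = spiderParent y := by
      constructor
      · rintro ⟨y', h, h'⟩
        rwa [Option.some_injective _ h']
      · exact fun h => ⟨y, h, rfl⟩
    rw [hex]
    obtain ⟨i, j, hj⟩ := y
    rcases u with _ | ⟨i', j', hj'⟩
    · simp only [SpiderStep, spiderParent]
      split_ifs with h <;> simp [h]
    · simp only [SpiderStep, spiderParent]
      split_ifs with h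
      · simp [h]
      · simp only [Option.some.injEq]
        constructor
        · rintro ⟨rfl, rfl⟩
          simp
        · intro h'
          obtain ⟨rfl, h''⟩ := Sigma.mk.inj_iff.1 h'
          simp only [heq_eq_eq, Fin.mk.injEq] at h''
          exact ⟨rfl, by omega⟩

theorem spiderParent_eq_some {y y' : Σ i : Fin Δ, Fin (ℓ i)}
    (h : spiderParent y = some y') : (y.2 : ℕ) = y'.2 + 1 :=
  (spiderStep_iff.2 ⟨y, h.symm, rfl⟩ : SpiderStep (some y') (some y)).2

theorem spiderEdge_injective : Function.Injective (spiderEdge (ℓ := ℓ)) := by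
  intro y y' h
  rcases Sym2.eq_iff.1 h with ⟨-, h⟩ | ⟨h, h'⟩
  · exact Option.some_injective _ h
  · have := spiderParent_eq_some h
    have := spiderParent_eq_some h'.symm
    omega

theorem edgeSet_spiderGraph : (spiderGraph ℓ).edgeSet = Set.range (spiderEdge (ℓ := ℓ)) := by
  ext e
  induction e with
  | h u v =>
    rw [SimpleGraph.mem_edgeSet, spiderGraph, SimpleGraph.fromRel_adj, spiderStep_iff,
      spiderStep_iff, Set.mem_range]
    constructor
    · rintro ⟨-, ⟨y, rfl, rfl⟩ | ⟨y, rfl, rfl⟩⟩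
      exacts [⟨y, rfl⟩, ⟨y, Sym2.eq_swap⟩]
    · rintro ⟨y, h⟩
      have hne : spiderParent y ≠ some y := fun h' => by
        have := spiderParent_eq_some h'
        omega
      rcases Sym2.eq_iff.1 h with ⟨rfl, rfl⟩ | ⟨rfl, rfl⟩
      exacts [⟨hne, .inl ⟨y, rfl, rfl⟩⟩, ⟨hne.symm, .inr ⟨y, rfl, rfl⟩⟩]

theorem ncard_edgeSet_spiderGraph : (spiderGraph ℓ).edgeSet.ncard = ∑ i, ℓ i := by
  rw [edgeSet_spiderGraph, ← Set.image_univ, Set.ncard_image_of_injective _ spiderEdge_injective,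
    Set.ncard_univ, Nat.card_eq_fintype_card, Fintype.card_sigma]
  simp

/-- A coloring of a spider amounts to one walk along each leg, all of them starting at the same
color; it is edge-distinguishing if no step is repeated. -/
theorem exists_isEdgeDistinguishing_iff {α : Type*} :
    (∃ c : SpiderVertex ℓ → α, (spiderGraph ℓ).IsEdgeDistinguishing c) ↔
      ∃ (v : α) (f : Fin Δ → ℕ → α), (∀ i, f i 0 = v) ∧
        Function.Injective
          (fun y : Σ i : Fin Δ, Fin (ℓ i) => s(f y.1 y.2, f y.1 (y.2 + 1))) := by
  have hcomp (c : SpiderVertex ℓ → α) : (spiderGraph ℓ).IsEdgeDistinguishing c ↔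
      Function.Injective (fun y => s(c (spiderParent y), c (some y))) := by
    rw [SimpleGraph.IsEdgeDistinguishing, edgeSet_spiderGraph]
    constructor
    · intro h y y' hyy'
      exact spiderEdge_injective (h ⟨y, rfl⟩ ⟨y', rfl⟩ hyy')
    · rintro h _ ⟨y, rfl⟩ _ ⟨y', rfl⟩ hyy'
      rw [h hyy']
  have hwalk (c : SpiderVertex ℓ → α) (f : Fin Δ → ℕ → α) (h0 : ∀ i, f i 0 = c none)
      (hf : ∀ i j hj, f i (j + 1) = c (some ⟨i, j, hj⟩)) :
      (fun y : Σ i : Fin Δ, Fin (ℓ i) => s(f y.1 y.2, f y.1 (y.2 + 1))) =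
        fun y => s(c (spiderParent y), c (some y)) := by
    funext ⟨i, j, hj⟩
    have hpar : f i j = c (spiderParent ⟨i, j, hj⟩) := by
      rcases j with _ | j
      · exact h0 i
      · exact hf i j (by omega)
    simp only [hpar, hf i j hj]
  constructor
  · rintro ⟨c, hc⟩
    let f : Fin Δ → ℕ → α := fun i n =>
      Nat.casesOn n (c none) fun j => if hj : j < ℓ i then c (some ⟨i, j, hj⟩) else c none
    refine ⟨c none, f, fun _ => rfl, ?_⟩
    rw [hwalk c f (fun _ => rfl) fun i j hj => dif_pos hj]
    exact (hcomp c).1 hc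
  · rintro ⟨v, f, h0, hf⟩
    let c : SpiderVertex ℓ → α := fun u => u.elim v fun y => f y.1 (y.2 + 1)
    refine ⟨c, (hcomp c).2 ?_⟩
    rwa [← hwalk c f h0 fun _ _ _ => rfl]

end Spider

/-- `SpiderColorable ℓ k`: the spider with leg lengths `ℓ` has an edge-distinguishing coloring
with `k` colors. -/
def SpiderColorable {Δ : ℕ} (ℓ : Fin Δ → ℕ) (k : ℕ) : Prop :=
  ∃ c : SpiderVertex ℓ → Fin k, (spiderGraph ℓ).IsEdgeDistinguishing c

theorem edcn_spiderGraph_eq {Δ : ℕ} {ℓ : Fin Δ → ℕ} {k : ℕ} (h : SpiderColorable ℓ k)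
    (h' : ∀ n, SpiderColorable ℓ n → k ≤ n) : (spiderGraph ℓ).edcn = k :=
  (spiderGraph ℓ).isLeast_edcn.unique ⟨h, h'⟩

/-- Edge-disjoint trails with a common start vertex give a coloring of a spider whose legs are not
longer than the trails. -/
theorem SpiderColorable.of_trails {Δ : ℕ} {ℓ : Fin Δ → ℕ} {k v : ℕ} (hv : v < k)
    (S : Fin Δ → Finset (Sym2 ℕ)) (w : Fin Δ → ℕ) (hS : ∀ i, IsTrail (S i) v (w i))
    (hd : ∀ i j, i < j → Disjoint (S i) (S j)) (hk : ∀ i, S i ⊆ (Finset.range k).sym2)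
    (hℓ : ∀ i, ℓ i ≤ (S i).card) : SpiderColorable ℓ k := by
  choose f h0 hm hi using fun i => (hS i).exists_seq
  have hlt (i : Fin Δ) (j : ℕ) (hj : j ≤ ℓ i) : f i j < k := by
    rcases j with _ | j
    · rw [h0]
      exact hv
    · have := Finset.mem_sym2_iff.1 (hk i (hm i j (by have := hℓ i; omega)))
      exact Finset.mem_range.1 (this _ (Sym2.mem_mk_right _ _))
  let F : Fin Δ → ℕ → Fin k := fun i j => if hj : f i j < k then ⟨f i j, hj⟩ else ⟨v, hv⟩
  have hF (i : Fin Δ) (j : ℕ) (hj : j ≤ ℓ i) : (F i j : ℕ) = f i j := by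
    simp only [F, dif_pos (hlt i j hj)]
  refine exists_isEdgeDistinguishing_iff.2 ⟨⟨v, hv⟩, F, fun i => ?_, ?_⟩
  · exact Fin.ext ((hF i 0 (Nat.zero_le _)).trans (h0 i))
  · rintro ⟨i, j, hj⟩ ⟨i', j', hj'⟩ h
    have h' := congrArg (Sym2.map Fin.val) h
    simp only [Sym2.map_mk] at h'
    rw [hF i j hj.le, hF i (j + 1) hj, hF i' j' hj'.le, hF i' (j' + 1) hj'] at h'
    have h1 := hm i j (hj.trans_le (hℓ i))
    have h2 := hm i' j' (hj'.trans_le (hℓ i'))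
    obtain rfl : i = i' := by
      by_contra hne
      rcases lt_or_gt_of_ne hne with hlt | hlt
      · exact Finset.disjoint_left.1 (hd _ _ hlt) h1 (h' ▸ h2)
      · exact Finset.disjoint_left.1 (hd _ _ hlt) h2 (h' ▸ h1)
    obtain rfl := hi i j (hj.trans_le (hℓ i)) j' (hj'.trans_le (hℓ i)) h'
    rfl

/-! ### Colorings with few colors -/

/-- Legs may be permuted, omitted and shortened. -/
theorem SpiderColorable.of_le_comp {Δ Δ' : ℕ} {ℓ : Fin Δ → ℕ} {ℓ' : Fin Δ' → ℕ} {k : ℕ}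
    (h : SpiderColorable ℓ k) (σ : Fin Δ' → Fin Δ) (hσ : Function.Injective σ)
    (hle : ∀ i, ℓ' i ≤ ℓ (σ i)) : SpiderColorable ℓ' k := by
  obtain ⟨v, f, h0, hf⟩ := exists_isEdgeDistinguishing_iff.1 h
  refine exists_isEdgeDistinguishing_iff.2 ⟨v, fun i => f (σ i), fun i => h0 (σ i), ?_⟩
  rintro ⟨i, j, hj⟩ ⟨i', j', hj'⟩ heq
  have := @hf ⟨σ i, j, hj.trans_le (hle i)⟩ ⟨σ i', j', hj'.trans_le (hle i')⟩ heq
  obtain ⟨h1, h2⟩ := Sigma.mk.inj_iff.1 this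
  obtain rfl := hσ h1
  simp only [heq_eq_eq, Fin.mk.injEq] at h2
  subst h2
  rfl

theorem SpiderColorable.of_four_trails {k w₁ w₂ w₃ w₄ : ℕ} {S₁ S₂ S₃ S₄ : Finset (Sym2 ℕ)}
    (hk : 0 < k) (h₁ : IsTrail S₁ 0 w₁) (h₂ : IsTrail S₂ 0 w₂) (h₃ : IsTrail S₃ 0 w₃)
    (h₄ : IsTrail S₄ 0 w₄) (h₁₂ : Disjoint S₁ S₂) (h₃₄ : Disjoint S₃ S₄)
    (hd : Disjoint (S₁ ∪ S₂) (S₃ ∪ S₄)) (hs : S₁ ∪ S₂ ⊆ (Finset.range k).sym2)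
    (hs' : S₃ ∪ S₄ ⊆ (Finset.range k).sym2) :
    SpiderColorable ![S₁.card, S₂.card, S₃.card, S₄.card] k := by
  simp only [Finset.disjoint_union_left, Finset.disjoint_union_right] at hd
  obtain ⟨⟨h₁₃, h₁₄⟩, h₂₃, h₂₄⟩ := hd
  obtain ⟨hs₁, hs₂⟩ := Finset.union_subset_iff.1 hs
  obtain ⟨hs₃, hs₄⟩ := Finset.union_subset_iff.1 hs'
  refine .of_trails hk ![S₁, S₂, S₃, S₄] ![w₁, w₂, w₃, w₄] ?_ ?_ ?_ ?_
  · intro i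
    fin_cases i <;> assumption
  · intro i j hij
    fin_cases i <;> fin_cases j <;> first | assumption | simp at hij
  · intro i
    fin_cases i <;> assumption
  · intro i
    fin_cases i <;> rfl

/-- A spider with two legs attached to each of two closed trails. -/
theorem ClosedSplit.spiderColorable {P : Finset (Sym2 ℕ) → Prop} {k a b m n : ℕ} (hk : 0 < k)
    (h : ClosedSplit P k a b) (hm : m ≤ a) (hn : n ≤ b) :
    SpiderColorable ![m, a - m, n, b - n] k := by
  obtain ⟨A, B, hA, hB, hAB, hAk, hBk, rfl, rfl, -, -⟩ := h
  obtain ⟨p, S, S', rfl, hS, rfl, hS₁, hS₂⟩ := hA.exists_split m hm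
  obtain ⟨q, T, T', rfl, hT, rfl, hT₁, hT₂⟩ := hB.exists_split n hn
  have := SpiderColorable.of_four_trails hk hS₁ hS₂.reverse hT₁ hT₂.reverse hS hT hAB hAk hBk
  rwa [Finset.card_union_of_disjoint hS, Finset.card_union_of_disjoint hT,
    Nat.add_sub_cancel_left, Nat.add_sub_cancel_left]

/-- For odd `k` the only restriction is the number of edges, unless three legs have length `1`: the
first and the third leg have total length at least `3`, and so do the other two. -/
theorem spiderColorable_of_odd {ℓ₁ ℓ₂ ℓ₃ ℓ₄ k : ℕ} (h₁ : 1 ≤ ℓ₁) (h₁₂ : ℓ₁ ≤ ℓ₂) (h₃₄ : ℓ₃ ≤ ℓ₄)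
    (h₃ : 2 ≤ ℓ₃) (hk : Odd k) (h5 : 5 ≤ k) (he : 2 * (ℓ₁ + ℓ₂ + ℓ₃ + ℓ₄) ≤ k * (k + 1)) :
    SpiderColorable ![ℓ₁, ℓ₂, ℓ₃, ℓ₄] k := by
  obtain ⟨t, ht⟩ : ∃ t, k * (k + 1) = 2 * t := (Nat.even_mul_succ_self k).two_dvd
  have h := (closedSplit_of_odd hk h5 (a := ℓ₁ + ℓ₃) (b := t - (ℓ₁ + ℓ₃)) (by omega) (by omega)
    (by omega)).spiderColorable (by omega) (m := ℓ₁) (n := ℓ₂) (by omega) (by omega)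
  refine h.of_le_comp ![0, 2, 1, 3] (by decide) fun i => ?_
  fin_cases i <;> simp
  omega

theorem mate_lt {k x : ℕ} (hk : Even k) (hx : x < k) : mate x < k := by
  obtain ⟨r, rfl⟩ := hk
  unfold mate
  split_ifs <;> omega

theorem matchingEdge_eq_iff {x y : ℕ} : s(x, mate x) = s(y, mate y) ↔ x = y ∨ x = mate y := by
  rw [Sym2.eq_iff]
  constructor
  · rintro (⟨h, -⟩ | ⟨h, -⟩)
    exacts [.inl h, .inr h]
  · rintro (rfl | rfl)
    exacts [.inl ⟨rfl, rfl⟩, .inr ⟨rfl, mate_mate y⟩]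

/-- Consider the step `{p, q}` of a closed trail that is preceded by `n` other steps. At either of
its ends the trail can be cut, and an edge of the matching be added, in such a way that
the two resulting trails have lengths `n + 1` and `A.card - n`. -/
theorem IsTrail.exists_cut {A : Finset (Sym2 ℕ)} (hA : IsTrail A 0 0) {n : ℕ} (hn : n < A.card) :
    ∃ p q, s(p, q) ∈ A ∧ ∀ z, z = p ∨ z = q → s(z, mate z) ∉ A →
      ∃ S T x y, S ∪ T = insert s(z, mate z) A ∧ Disjoint S T ∧ S.card = n + 1 ∧
        T.card = A.card - n ∧ IsTrail S 0 x ∧ IsTrail T 0 y := by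
  obtain ⟨p, S, T₀, rfl, hd, rfl, hS, hT₀⟩ := hA.exists_split n hn.le
  have hcard := Finset.card_union_of_disjoint hd
  obtain ⟨q, T, hq, rfl, hT⟩ := hT₀.exists_first_step (by omega)
  rw [Finset.disjoint_insert_right] at hd
  rw [Finset.card_insert_of_notMem hq] at hcard
  refine ⟨p, q, by simp, ?_⟩
  rintro z (rfl | rfl) hz
  · simp only [Finset.mem_union, Finset.mem_insert, not_or] at hz
    have hz' : Disjoint S {s(z, mate z)} := by simpa using hz.1
    refine ⟨S ∪ {s(z, mate z)}, insert s(z, q) T, _, _, ?_, ?_, ?_, ?_,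
      hS.append (IsTrail.single z (mate z)) hz', (IsTrail.cons hq hT).reverse⟩
    · ext e
      simp only [Finset.mem_union, Finset.mem_insert, Finset.mem_singleton]
      tauto
    · rw [Finset.disjoint_union_left, Finset.disjoint_insert_right]
      refine ⟨hd, ?_⟩
      simp [hz.2.1, hz.2.2]
    · rw [Finset.card_union_of_disjoint hz', Finset.card_singleton]
    · rw [Finset.card_insert_of_notMem hq, hcard, Nat.add_sub_cancel_left]
  · simp only [Finset.mem_union, Finset.mem_insert, not_or] at hz
    have hz' : Disjoint T {s(z, mate z)} := by simpa using hz.2.2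
    have hp : Disjoint S {s(p, z)} := by simpa using hd.1
    refine ⟨S ∪ {s(p, z)}, T ∪ {s(z, mate z)}, _, _, ?_, ?_, ?_, ?_,
      hS.append (IsTrail.single p z) hp, hT.reverse.append (IsTrail.single z (mate z)) hz'⟩
    · ext e
      simp only [Finset.mem_union, Finset.mem_insert, Finset.mem_singleton]
      tauto
    · rw [Finset.disjoint_union_left, Finset.disjoint_union_right, Finset.disjoint_union_right]
      refine ⟨⟨hd.2, by simpa using hz.1⟩, by simpa using hq, ?_⟩
      simpa using Ne.symm hz.2.1
    · rw [Finset.card_union_of_disjoint hp, Finset.card_singleton]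
    · rw [Finset.card_union_of_disjoint hz', Finset.card_singleton, hcard,
        Nat.add_sub_cancel_left]

/-- When two closed trails are cut at one step each, the ends of the cuts can be chosen so that
different edges of the matching become available. Otherwise both steps would be loops, at equal or
partnered vertices, and the loops at partners are in the same trail. -/
theorem exists_ne_matchingEdge {A B : Finset (Sym2 ℕ)} (hA : MateBalanced A) (hB : MateBalanced B)
    (hd : Disjoint A B) {p q r t : ℕ} (hpq : s(p, q) ∈ A) (hrt : s(r, t) ∈ B) :
    ∃ z w, (z = p ∨ z = q) ∧ (w = r ∨ w = t) ∧ s(z, mate z) ≠ s(w, mate w) := by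
  by_contra! hcon
  have hpr := hcon p r (.inl rfl) (.inl rfl)
  have hqr := hcon q r (.inr rfl) (.inl rfl)
  have hpt := hcon p t (.inl rfl) (.inr rfl)
  obtain rfl : q = p := by
    rcases matchingEdge_eq_iff.1 (hqr.trans hpr.symm) with h | h
    · exact h
    · exact absurd (h ▸ hpq) (hA p).1
  obtain rfl : t = r := by
    rcases matchingEdge_eq_iff.1 (hpt.symm.trans hpr) with h | h
    · exact h
    · exact absurd (h ▸ hrt) (hB r).1
  rcases matchingEdge_eq_iff.1 hpr with rfl | rfl
  · exact Finset.disjoint_left.1 hd hpq hrt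
  · exact Finset.disjoint_left.1 hd hpq ((hB t).2 hrt)

/-- Two legs attached to each of two closed trails, where one leg of each pair is prolonged by an
edge of the matching. -/
theorem ClosedSplit.spiderColorable_of_mate {k a b m n : ℕ} (hk : 0 < k) (hke : Even k)
    (h : ClosedSplit MateBalanced k a b) (hm : m < a) (hn : n < b) :
    SpiderColorable ![m + 1, a - m, n + 1, b - n] k := by
  obtain ⟨A, B, hA, hB, hAB, hAk, hBk, rfl, rfl, hPA, hPB⟩ := h
  obtain ⟨p, q, hpq, hcutA⟩ := hA.exists_cut hm
  obtain ⟨r, t, hrt, hcutB⟩ := hB.exists_cut hn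
  obtain ⟨z, w, hz, hw, hne⟩ := exists_ne_matchingEdge hPA hPB hAB hpq hrt
  obtain ⟨S, T, x, y, hST, hSTd, hS, hT, hSt, hTt⟩ := hcutA z hz (hPA z).1
  obtain ⟨S', T', x', y', hST', hSTd', hS', hT', hSt', hTt'⟩ := hcutB w hw (hPB w).1
  have hlt {D : Finset (Sym2 ℕ)} {i j y : ℕ} (hD : D ⊆ (Finset.range k).sym2) (hij : s(i, j) ∈ D)
      (hy : y = i ∨ y = j) : insert s(y, mate y) D ⊆ (Finset.range k).sym2 := by
    have := Finset.mk_mem_sym2_iff.1 (hD hij)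
    simp only [Finset.mem_range] at this
    have hyk : y < k := by rcases hy with rfl | rfl <;> omega
    refine Finset.insert_subset (Finset.mk_mem_sym2_iff.2 ?_) hD
    exact ⟨Finset.mem_range.2 hyk, Finset.mem_range.2 (mate_lt hke hyk)⟩
  rw [← hS, ← hT, ← hS', ← hT']
  refine .of_four_trails hk hSt hTt hSt' hTt' hSTd hSTd' ?_ (hST ▸ hlt hAk hpq hz)
    (hST' ▸ hlt hBk hrt hw)
  rw [hST, hST', Finset.disjoint_insert_left, Finset.disjoint_insert_right]
  simp only [Finset.mem_insert, not_or]
  exact ⟨⟨hne, (hPB z).1⟩, (hPA w).1, hAB⟩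

/-- The first two legs are the loop and the matching edge at `0`. A closed trail `B` on the other
edges that are not in the matching provides the remaining two: with `{0, x}` as its first step, it
is cut at `x`, and one of the two parts is prolonged by the matching edge at `x`. -/
theorem spiderColorable_one_one_of_even {k t : ℕ} (hk : Even k) (h6 : 6 ≤ k)
    (ht : k * k = 2 * t) :
    SpiderColorable ![1, 1, 1, t - 1] k ∧ SpiderColorable ![1, 1, 2, t - 2] k := by
  obtain ⟨B, hB, hBk, hcard, h00, hmate⟩ := exists_closedTrail_of_even hk h6
  have h01 : s(0, 1) ∉ B := hmate 0
  have h36 : 6 * 6 ≤ k * k := Nat.mul_le_mul h6 h6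
  obtain ⟨x, R, hx, rfl, hR⟩ := hB.exists_first_step (by omega)
  rw [Finset.card_insert_of_notMem hx] at hcard
  simp only [Finset.mem_insert, not_or] at h00 h01 hmate
  have hxk : x < k := by
    have := Finset.mk_mem_sym2_iff.1 (hBk (Finset.mem_insert_self _ _))
    exact Finset.mem_range.1 this.2
  have hx0 : x ≠ 0 := by
    rintro rfl
    exact h00.1 rfl
  have hx1 : x ≠ 1 := by
    rintro rfl
    exact h01.1 rfl
  have hxmate : ∀ y < 2, s(0, y) ≠ s(x, mate x) := by
    intro y hy h
    unfold mate at h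
    rcases Sym2.eq_iff.1 h with ⟨h, -⟩ | ⟨h, h'⟩
    · exact hx0 h.symm
    · omega
  have hd : Disjoint {s(0, 0)} ({s(0, 1)} : Finset (Sym2 ℕ)) := by simp
  have hs : {s(0, 0)} ∪ {s(0, 1)} ⊆ (Finset.range k).sym2 := by
    intro e he
    simp only [Finset.mem_union, Finset.mem_singleton] at he
    rcases he with rfl | rfl <;> simp <;> omega
  have hs' : insert s(x, mate x) (insert s(0, x) R) ⊆ (Finset.range k).sym2 := by
    refine Finset.insert_subset (Finset.mk_mem_sym2_iff.2 ?_) hBk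
    exact ⟨Finset.mem_range.2 hxk, Finset.mem_range.2 (mate_lt hk hxk)⟩
  have hdd : Disjoint ({s(0, 0)} ∪ {s(0, 1)}) (insert s(x, mate x) (insert s(0, x) R)) := by
    rw [Finset.disjoint_union_left, Finset.disjoint_singleton_left,
      Finset.disjoint_singleton_left]
    simp only [Finset.mem_insert, not_or]
    exact ⟨⟨hxmate 0 (by omega), h00⟩, hxmate 1 (by omega), h01⟩
  have hRx : Disjoint R {s(x, mate x)} := by simpa using (hmate x).2
  constructor
  · have hU : {s(0, x)} ∪ (R ∪ {s(x, mate x)}) = insert s(x, mate x) (insert s(0, x) R) := by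
      ext e
      simp only [Finset.mem_union, Finset.mem_insert, Finset.mem_singleton]
      tauto
    have h := SpiderColorable.of_four_trails (by omega) (IsTrail.single 0 0)
      (IsTrail.single 0 1) (IsTrail.single 0 x)
      (hR.reverse.append (IsTrail.single x (mate x)) hRx) hd
      (by simpa [hx] using Ne.symm (hmate x).1) (hU ▸ hdd) hs (hU ▸ hs')
    rw [Finset.card_union_of_disjoint hRx] at h
    simp only [Finset.card_singleton] at h
    rwa [show t - 1 = R.card + 1 by omega]
  · have h0x : Disjoint {s(0, x)} ({s(x, mate x)} : Finset (Sym2 ℕ)) := by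
      simpa using Ne.symm (hmate x).1
    have hU : ({s(0, x)} ∪ {s(x, mate x)}) ∪ R = insert s(x, mate x) (insert s(0, x) R) := by
      ext e
      simp only [Finset.mem_union, Finset.mem_insert, Finset.mem_singleton]
      tauto
    have h := SpiderColorable.of_four_trails (by omega) (IsTrail.single 0 0)
      (IsTrail.single 0 1) ((IsTrail.single 0 x).append (IsTrail.single x (mate x)) h0x)
      hR.reverse hd (by simpa [hx] using (hmate x).2) (hU ▸ hdd) hs (hU ▸ hs')
    rw [Finset.card_union_of_disjoint h0x] at h
    simp only [Finset.card_singleton] at h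
    rwa [show t - 2 = R.card by omega]

/-- For even `k` the only restriction is the one on the number of edges that is forced by parity. -/
theorem spiderColorable_of_even {ℓ₁ ℓ₂ ℓ₃ ℓ₄ k : ℕ} (h₁ : 1 ≤ ℓ₁) (h₁₂ : ℓ₁ ≤ ℓ₂) (h₂₃ : ℓ₂ ≤ ℓ₃)
    (h₃₄ : ℓ₃ ≤ ℓ₄) (hk : Even k) (h6 : 6 ≤ k)
    (he : 2 * (ℓ₁ + ℓ₂ + ℓ₃ + ℓ₄) ≤ k * k + 4) : SpiderColorable ![ℓ₁, ℓ₂, ℓ₃, ℓ₄] k := by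
  obtain ⟨t, ht⟩ : ∃ t, k * k = 2 * t := (hk.mul_left k).two_dvd
  have h36 : 6 * 6 ≤ k * k := Nat.mul_le_mul h6 h6
  -- One closed trail carries two legs and one matching edge less, so that it has length
  -- `ℓ₁ + ℓ₃ - 1`; there are closed trails of length at least `3`, but none of length `2`.
  by_cases h4 : 4 ≤ ℓ₁ + ℓ₃
  · have h := (closedSplit_of_even hk h6 (a := ℓ₁ + ℓ₃ - 1) (b := t - (ℓ₁ + ℓ₃ - 1)) (by omega)
      (by omega) (by omega)).spiderColorable_of_mate (by omega) hk (m := ℓ₁ - 1) (n := ℓ₂ - 1)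
      (by omega) (by omega)
    refine h.of_le_comp ![0, 2, 1, 3] (by decide) fun i => ?_
    fin_cases i <;> simp <;> omega
  -- For the leg lengths `1, 2, 2, ℓ₄`, the second and third leg share a closed trail of length `3`.
  by_cases h2 : ℓ₂ = 2
  · have h := (closedSplit_of_even hk h6 (a := ℓ₂ + ℓ₃ - 1) (b := t - (ℓ₂ + ℓ₃ - 1)) (by omega)
      (by omega) (by omega)).spiderColorable_of_mate (by omega) hk (m := ℓ₂ - 1) (n := ℓ₁ - 1)
      (by omega) (by omega)
    refine h.of_le_comp ![2, 0, 1, 3] (by decide) fun i => ?_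
    fin_cases i <;> simp <;> omega
  obtain ⟨hone, htwo⟩ := spiderColorable_one_one_of_even hk h6 ht
  rcases (by omega : ℓ₃ = 1 ∨ ℓ₃ = 2) with h3 | h3
  · refine hone.of_le_comp id Function.injective_id fun i => ?_
    fin_cases i <;> simp <;> omega
  · refine htwo.of_le_comp id Function.injective_id fun i => ?_
    fin_cases i <;> simp <;> omega

theorem spiderColorable_one_one_one_of_odd {ℓ k : ℕ} (hk : Odd k) (h5 : 5 ≤ k)
    (he : 2 * (ℓ + 4) ≤ k * (k + 1)) : SpiderColorable ![1, 1, 1, ℓ] k := by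
  obtain ⟨B, hB, hBk, hcard, h0, h1, h2⟩ := exists_closedTrail_of_odd hk h5
  have h := SpiderColorable.of_four_trails (k := k) (by omega) (IsTrail.single 0 0)
    (IsTrail.single 0 1) (IsTrail.single 0 2) hB (by simp) (by simpa using h2)
    (by simp [h0, h1]) (by intro e; simp; rintro (rfl | rfl) <;> simp <;> omega)
    (Finset.union_subset (by intro e; simp; rintro rfl; simp; omega) hBk)
  refine h.of_le_comp id Function.injective_id fun i => ?_
  fin_cases i <;> simp
  omega

theorem SpiderColorable.of_four_walks (k : ℕ) (l₁ l₂ l₃ l₄ : List ℕ)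
    (hnd : ((walkEdges (0 :: l₁) ++ walkEdges (0 :: l₂)) ++
      (walkEdges (0 :: l₃) ++ walkEdges (0 :: l₄))).Nodup)
    (hk : ∀ x ∈ ((0 :: l₁) ++ (0 :: l₂)) ++ ((0 :: l₃) ++ (0 :: l₄)), x < k) :
    SpiderColorable ![l₁.length, l₂.length, l₃.length, l₄.length] k := by
  simp only [List.nodup_append', List.disjoint_append_left, List.disjoint_append_right] at hnd
  obtain ⟨⟨h1, h2, h12⟩, ⟨h3, h4, h34⟩, ⟨h13, h23⟩, h14, h24⟩ := hnd
  simp only [List.forall_mem_append] at hk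
  rw [← card_walkEdges h1, ← card_walkEdges h2, ← card_walkEdges h3, ← card_walkEdges h4]
  refine .of_four_trails (hk.1.1 0 (by simp)) (.of_walkEdges _ _ h1) (.of_walkEdges _ _ h2)
    (.of_walkEdges _ _ h3) (.of_walkEdges _ _ h4) (List.disjoint_toFinset_iff_disjoint.2 h12)
    (List.disjoint_toFinset_iff_disjoint.2 h34) ?_
    (Finset.union_subset (walkEdges_subset hk.1.1) (walkEdges_subset hk.1.2))
    (Finset.union_subset (walkEdges_subset hk.2.1) (walkEdges_subset hk.2.2))
  simp only [Finset.disjoint_union_left, Finset.disjoint_union_right,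
    List.disjoint_toFinset_iff_disjoint]
  exact ⟨⟨h13, h23⟩, h14, h24⟩

/-- Four colors suffice if the shortest leg is a single edge and there are at most ten edges. After
the last leg has been prolonged, there are exactly ten, and seven spiders remain. -/
theorem spiderColorable_four {ℓ₂ ℓ₃ ℓ₄ : ℕ} (h₁₂ : 1 ≤ ℓ₂) (h₂₃ : ℓ₂ ≤ ℓ₃) (h₃₄ : ℓ₃ ≤ ℓ₄)
    (he : 1 + ℓ₂ + ℓ₃ + ℓ₄ ≤ 10) : SpiderColorable ![1, ℓ₂, ℓ₃, ℓ₄] 4 := by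
  suffices h : SpiderColorable ![1, ℓ₂, ℓ₃, 9 - ℓ₂ - ℓ₃] 4 by
    refine h.of_le_comp id Function.injective_id fun i => ?_
    fin_cases i <;> simp
    omega
  have h2 : ℓ₂ ≤ 3 := by omega
  have h3 : 2 * ℓ₃ ≤ 9 - ℓ₂ := by omega
  clear he h₃₄
  interval_cases ℓ₂
  · have h4 : ℓ₃ ≤ 4 := by omega
    interval_cases ℓ₃
    · exact SpiderColorable.of_four_walks 4 [2] [3] [0] [1, 3, 3, 2, 2, 1, 1]
        (by decide) (by decide)
    · exact SpiderColorable.of_four_walks 4 [0] [3] [2, 1] [1, 1, 3, 3, 2, 2]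
        (by decide) (by decide)
    · exact SpiderColorable.of_four_walks 4 [1] [0] [2, 3, 3] [3, 1, 1, 2, 2]
        (by decide) (by decide)
    · exact SpiderColorable.of_four_walks 4 [1] [0] [3, 1, 1, 2] [2, 2, 3, 3]
        (by decide) (by decide)
  · have h4 : ℓ₃ ≤ 3 := by omega
    interval_cases ℓ₃
    · exact SpiderColorable.of_four_walks 4 [0] [1, 1] [2, 3] [3, 3, 1, 2, 2]
        (by decide) (by decide)
    · exact SpiderColorable.of_four_walks 4 [0] [3, 2] [1, 3, 3] [2, 2, 1, 1]
        (by decide) (by decide)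
  · obtain rfl : ℓ₃ = 3 := by omega
    exact SpiderColorable.of_four_walks 4 [0] [2, 1, 1] [1, 3, 3] [3, 2, 2]
        (by decide) (by decide)

/-! ### Lower bounds -/

section LowerBounds

variable {Δ n : ℕ} {ℓ : Fin Δ → ℕ}

theorem SpiderColorable.two_mul_sum_le (h : SpiderColorable ℓ n) :
    2 * ∑ i, ℓ i ≤ n * (n + 1) := by
  obtain ⟨v, f, -, hf⟩ := exists_isEdgeDistinguishing_iff.1 h
  have := Fintype.card_le_of_injective _ hf
  simp only [Fintype.card_sigma, Fintype.card_fin, Sym2.card] at this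
  rw [Nat.choose_two_right, Nat.add_sub_cancel] at this
  have := Nat.div_mul_le_self ((n + 1) * n) 2
  rw [mul_comm n]
  omega

/-- The first edges of the legs have different labels that all contain the central color. -/
theorem injective_walk_one {α : Type*} {v : α} {f : Fin Δ → ℕ → α} (h0 : ∀ i, f i 0 = v)
    (hf : Function.Injective
      (fun y : Σ i : Fin Δ, Fin (ℓ i) => s(f y.1 y.2, f y.1 (y.2 + 1))))
    (hℓ : ∀ i, 1 ≤ ℓ i) : Function.Injective fun i => f i 1 := by
  intro i j hij
  have := @hf ⟨i, 0, hℓ i⟩ ⟨j, 0, hℓ j⟩ (by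
    simp only [h0, zero_add]
    exact congrArg (s(v, ·)) hij)
  exact congrArg Sigma.fst this

theorem SpiderColorable.le (h : SpiderColorable ℓ n) (hℓ : ∀ i, 1 ≤ ℓ i) : Δ ≤ n := by
  obtain ⟨v, f, h0, hf⟩ := exists_isEdgeDistinguishing_iff.1 h
  simpa using Fintype.card_le_of_injective _ (injective_walk_one h0 hf hℓ)

/-- With `Δ` colors all edges at the central color are used by the first edges of the legs, so
that the leg which starts with the loop cannot be continued. -/
theorem SpiderColorable.lt (h : SpiderColorable ℓ n) (hℓ : ∀ i, 2 ≤ ℓ i) : Δ < n := by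
  refine (h.le fun i => one_le_two.trans (hℓ i)).lt_of_ne ?_
  rintro rfl
  obtain ⟨v, f, h0, hf⟩ := exists_isEdgeDistinguishing_iff.1 h
  have hsurj := Finite.surjective_of_injective
    (injective_walk_one h0 hf fun i => one_le_two.trans (hℓ i))
  obtain ⟨i, hi⟩ := hsurj v
  obtain ⟨j, hj⟩ := hsurj (f i 2)
  have := @hf ⟨j, 0, by have := hℓ j; omega⟩ ⟨i, 1, hℓ i⟩ (by simp_all)
  obtain ⟨rfl, h'⟩ := Sigma.mk.inj_iff.1 this
  simp at h'

/-- The number of ends of an edge `e` at the vertex `x`, modulo `2`; it is `0` for the loop. -/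
def incMod2 (x : Fin n) (e : Sym2 (Fin n)) : ZMod 2 := if x ∈ e ∧ ¬ e.IsDiag then 1 else 0

theorem incMod2_mk (x a b : Fin n) :
    incMod2 x s(a, b) = (if a = x then 1 else 0) + (if b = x then 1 else 0) := by
  have h2 : (1 : ZMod 2) + 1 = 0 := rfl
  unfold incMod2
  simp only [Sym2.mem_iff, Sym2.mk_isDiag_iff]
  by_cases ha : a = x <;> by_cases hb : b = x
  · subst ha
    subst hb
    simp [h2]
  · subst ha
    simp [hb, Ne.symm hb]
  · subst hb
    simp [ha]
  · simp [ha, hb, Ne.symm ha, Ne.symm hb]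

theorem sum_incMod2 (x : Fin n) : ∑ e, incMod2 x e = n + 1 := by
  have hfilter : Finset.univ.filter (fun e : Sym2 (Fin n) => x ∈ e ∧ ¬ e.IsDiag) =
      (⊤ : SimpleGraph (Fin n)).incidenceFinset x := by
    ext e
    simp [SimpleGraph.incidenceFinset_eq_filter, and_comm]
  have hn : 1 ≤ n := x.pos
  unfold incMod2
  rw [← Finset.sum_filter, hfilter, Finset.sum_const, SimpleGraph.card_incidenceFinset_eq_degree,
    SimpleGraph.complete_graph_degree, Fintype.card_fin, nsmul_one, Nat.cast_sub hn,
    CharTwo.sub_eq_add, Nat.cast_one]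

theorem sum_range_add_succ (g : ℕ → ZMod 2) (m : ℕ) :
    ∑ j ∈ Finset.range m, (g j + g (j + 1)) = g 0 + g m := by
  induction m with
  | zero => simp [CharTwo.add_self_eq_zero]
  | succ m ih =>
    rw [Finset.sum_range_succ, ih, add_assoc, ← add_assoc (g m), CharTwo.add_self_eq_zero, zero_add]

/-- For an even number of legs, the parity of the number of unused edges at a color is determined
by the number of legs that end there. -/
theorem sum_incMod2_unused {v : Fin n} {f : Fin Δ → ℕ → Fin n} (h0 : ∀ i, f i 0 = v)
    (hf : Function.Injective
      (fun y : Σ i : Fin Δ, Fin (ℓ i) => s(f y.1 y.2, f y.1 (y.2 + 1))))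
    (hΔ : Even Δ) (x : Fin n) :
    ∑ e ∈ (Finset.univ.image
      fun y : Σ i : Fin Δ, Fin (ℓ i) => s(f y.1 y.2, f y.1 (y.2 + 1)))ᶜ, incMod2 x e =
      n + 1 + ∑ i, if f i (ℓ i) = x then 1 else 0 := by
  have hsum := Finset.sum_add_sum_compl (Finset.univ.image
    fun y : Σ i : Fin Δ, Fin (ℓ i) => s(f y.1 y.2, f y.1 (y.2 + 1))) (incMod2 x)
  rw [sum_incMod2, Finset.sum_image hf.injOn, Fintype.sum_sigma] at hsum
  have hleg (i : Fin Δ) : ∑ j : Fin (ℓ i), incMod2 x s(f i j, f i (j + 1)) =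
      (if v = x then 1 else 0) + if f i (ℓ i) = x then 1 else 0 := by
    simp only [incMod2_mk]
    rw [Fin.sum_univ_eq_sum_range
      (fun j => (if f i j = x then (1 : ZMod 2) else 0) + if f i (j + 1) = x then 1 else 0),
      sum_range_add_succ (fun j => if f i j = x then 1 else 0), h0]
  simp only [hleg] at hsum
  rw [Finset.sum_add_distrib, Finset.sum_const, Finset.card_fin, nsmul_eq_mul,
    (ZMod.natCast_eq_zero_iff_even).2 hΔ, zero_mul, zero_add] at hsum
  rw [← hsum, add_right_comm, CharTwo.add_self_eq_zero, zero_add]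

/-- The number of pairs of colors is the number of edges plus the number of unused pairs. -/
theorem sum_add_card_unused {f : Fin Δ → ℕ → Fin n}
    (hf : Function.Injective
      (fun y : Σ i : Fin Δ, Fin (ℓ i) => s(f y.1 y.2, f y.1 (y.2 + 1)))) :
    2 * (∑ i, ℓ i + (Finset.univ.image
      fun y : Σ i : Fin Δ, Fin (ℓ i) => s(f y.1 y.2, f y.1 (y.2 + 1)))ᶜ.card) = n * (n + 1) := by
  have hcard := Finset.card_add_card_compl (Finset.univ.image
    fun y : Σ i : Fin Δ, Fin (ℓ i) => s(f y.1 y.2, f y.1 (y.2 + 1)))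
  rw [Sym2.card, Fintype.card_fin, Finset.card_image_of_injective _ hf, Finset.card_univ,
    Fintype.card_sigma, Nat.choose_two_right, Nat.add_sub_cancel] at hcard
  simp only [Fintype.card_fin] at hcard
  rw [hcard, mul_comm n, Nat.mul_div_cancel' (by
    rw [mul_comm]
    exact (Nat.even_mul_succ_self n).two_dvd)]

/-- For an even number `n` of colors the complete graph has odd degrees, so there is an unused edge
at every color at which no leg ends. -/
theorem SpiderColorable.two_mul_sum_le_of_even (h : SpiderColorable ℓ n) (hΔ : Even Δ)
    (hn : Even n) : 2 * ∑ i, ℓ i ≤ n * n + Δ := by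
  obtain ⟨v, f, h0, hf⟩ := exists_isEdgeDistinguishing_iff.1 h
  have hcard := sum_add_card_unused hf
  have hpar := sum_incMod2_unused h0 hf hΔ
  set M := (Finset.univ.image
    fun y : Σ i : Fin Δ, Fin (ℓ i) => s(f y.1 y.2, f y.1 (y.2 + 1)))ᶜ
  have hU : Finset.univ ⊆ (Finset.univ.image fun i => f i (ℓ i)) ∪ M.biUnion Sym2.toFinset := by
    intro x _
    by_contra hx
    simp only [Finset.mem_union, Finset.mem_image, Finset.mem_univ, true_and, Finset.mem_biUnion,
      Sym2.mem_toFinset, not_or, not_exists, not_and] at hx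
    have hx' := hpar x
    rw [Finset.sum_eq_zero (f := incMod2 x) fun e he => if_neg fun h => hx.2 e he h.1,
      Finset.sum_eq_zero fun i _ => if_neg (hx.1 i),
      (ZMod.natCast_eq_zero_iff_even).2 hn] at hx'
    exact absurd hx' (by decide)
  have h1 := (Finset.card_le_card hU).trans (Finset.card_union_le _ _)
  have h2 : (Finset.univ.image fun i => f i (ℓ i)).card ≤ Δ := by
    simpa using Finset.card_image_le (s := Finset.univ) (f := fun i => f i (ℓ i))
  have h3 : (M.biUnion Sym2.toFinset).card ≤ M.card * 2 :=
    Finset.card_biUnion_le_card_mul _ _ _ fun e _ => by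
      rw [Sym2.card_toFinset]
      split_ifs <;> omega
  rw [Finset.card_univ, Fintype.card_fin] at h1
  rw [mul_add, mul_add] at hcard
  omega

/-- For an odd number of colors the complete graph has even degrees. If all its edges are used,
then an even number of legs ends at every color; but three legs of length `1` end at three
different colors. -/
theorem SpiderColorable.two_mul_add_le_of_odd {l : ℕ} (h : SpiderColorable ![1, 1, 1, l] n)
    (hl : 1 ≤ l) (hn : Odd n) : 2 * (l + 3) + 2 ≤ n * (n + 1) := by
  obtain ⟨v, f, h0, hf⟩ := (exists_isEdgeDistinguishing_iff (Δ := 4)).1 h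
  have hcard := sum_add_card_unused hf
  have hpar := sum_incMod2_unused h0 hf (by decide)
  have hone := injective_walk_one h0 hf fun i => by fin_cases i <;> simp [hl]
  set M := (Finset.univ.image
    fun y : Σ i : Fin 4, Fin (![1, 1, 1, l] i) => s(f y.1 y.2, f y.1 (y.2 + 1)))ᶜ
  have hsum : ∑ i, ![1, 1, 1, l] i = l + 3 := by
    simp [Fin.sum_univ_four]
    omega
  rw [hsum] at hcard
  rcases Nat.eq_zero_or_pos M.card with hM | hM
  · rw [Finset.card_eq_zero] at hM
    have hn' : ((n : ZMod 2) + 1) = 0 := by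
      rw [← Nat.cast_succ, ZMod.natCast_eq_zero_iff_even]
      exact hn.add_one
    have hne (i j : Fin 4) (hij : i ≠ j) : f i 1 ≠ f j 1 := hone.ne hij
    simp only [hM, Finset.sum_empty, hn', zero_add, Fin.sum_univ_four, Matrix.cons_val] at hpar
    have h3 : f 3 l = f 0 1 := by
      by_contra hcon
      have := hpar (f 0 1)
      simp [hne 1 0 (by decide), hne 2 0 (by decide), hcon] at this
    have := hpar (f 1 1)
    simp [hne 0 1 (by decide), hne 2 1 (by decide), h3] at this
  · omega

end LowerBounds

/-! ### The values of the ceilings -/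

theorem ceil_sqrt_eight_mul_le {e n : ℕ} :
    ⌈(-1 + √(8 * (e : ℝ) + 1)) / 2⌉₊ ≤ n ↔ 2 * e ≤ n * (n + 1) := by
  have h : (-1 + √(8 * (e : ℝ) + 1)) / 2 ≤ n ↔ √(8 * (e : ℝ) + 1) ≤ 2 * n + 1 := by
    constructor <;> intro h <;> linarith
  rw [Nat.ceil_le, h, Real.sqrt_le_left (by positivity), ← @Nat.cast_le ℝ]
  push_cast
  constructor <;> intro h <;> nlinarith

theorem ceil_sqrt_two_mul_le {e n : ℕ} :
    ⌈√(2 * (e : ℝ) - 4)⌉₊ ≤ n ↔ 2 * e ≤ n * n + 4 := by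
  rw [Nat.ceil_le, Real.sqrt_le_left (by positivity), ← @Nat.cast_le ℝ]
  push_cast
  constructor <;> intro h <;> nlinarith

theorem mainTheorem1 (ℓ₁ ℓ₂ ℓ₃ ℓ₄ e : ℕ) (h₁ : 1 ≤ ℓ₁) (h₁₂ : ℓ₁ ≤ ℓ₂) (h₂₃ : ℓ₂ ≤ ℓ₃)
    (h₃₄ : ℓ₃ ≤ ℓ₄) (he : e = ℓ₁ + ℓ₂ + ℓ₃ + ℓ₄) :
    (spiderGraph ![ℓ₁, ℓ₂, ℓ₃, ℓ₄]).edgeSet.ncard = e ∧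
    (ℓ₃ = 1 →
      (spiderGraph ![ℓ₁, ℓ₂, ℓ₃, ℓ₄]).edcn =
        if e ≤ 10 then 4
        else if Odd ⌈(-1 + √(8 * (e : ℝ) + 9)) / 2⌉₊ then ⌈(-1 + √(8 * (e : ℝ) + 9)) / 2⌉₊
        else ⌈√(2 * (e : ℝ) - 4)⌉₊) ∧
    (2 ≤ ℓ₃ →
      (spiderGraph ![ℓ₁, ℓ₂, ℓ₃, ℓ₄]).edcn =
        if e ≤ 10 ∧ ℓ₁ = 1 then 4
        else if e ≤ 10 ∧ ℓ₁ = 2 then 5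
        else if 11 ≤ e ∧ Odd ⌈(-1 + √(8 * (e : ℝ) + 1)) / 2⌉₊ then
          ⌈(-1 + √(8 * (e : ℝ) + 1)) / 2⌉₊
        else ⌈√(2 * (e : ℝ) - 4)⌉₊) := by
  have hsum : ∑ i, ![ℓ₁, ℓ₂, ℓ₃, ℓ₄] i = e := by simp [Fin.sum_univ_four, he]
  have hge (n : ℕ) (h : SpiderColorable ![ℓ₁, ℓ₂, ℓ₃, ℓ₄] n) : 4 ≤ n :=
    h.le fun i => by fin_cases i <;> simp <;> omega
  have hle (n : ℕ) (h : SpiderColorable ![ℓ₁, ℓ₂, ℓ₃, ℓ₄] n) : 2 * e ≤ n * (n + 1) :=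
    hsum ▸ h.two_mul_sum_le
  have hle_even (n : ℕ) (h : SpiderColorable ![ℓ₁, ℓ₂, ℓ₃, ℓ₄] n) (hn : Even n) :
      2 * e ≤ n * n + 4 := hsum ▸ h.two_mul_sum_le_of_even (by decide) hn
  -- If the ceiling `m` of the first kind is even, then an odd `n ≥ m` exceeds `m`, which makes `n`
  -- at least the ceiling of the second kind.
  have hodd_step {d m n : ℕ} (hm : ¬ Odd m) (hn : Odd n) (hmn : m ≤ n)
      (hd : 2 * d ≤ m * (m + 1)) : 2 * d ≤ n * n + 4 := by
    have hlt : m < n := hmn.lt_of_ne fun h => hm (h ▸ hn)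
    nlinarith
  refine ⟨by rw [ncard_edgeSet_spiderGraph, hsum], fun h3 => ?_, fun h3 => ?_⟩
  · obtain rfl : ℓ₁ = 1 := by omega
    obtain rfl : ℓ₂ = 1 := by omega
    subst h3
    have hle_odd (n : ℕ) (h : SpiderColorable ![1, 1, 1, ℓ₄] n) (hn : Odd n) :
        2 * e + 2 ≤ n * (n + 1) := by
      have := h.two_mul_add_le_of_odd h₃₄ hn
      omega
    rw [show 8 * (e : ℝ) + 9 = 8 * ((e + 1 : ℕ) : ℝ) + 1 by push_cast; ring]
    have hm (n : ℕ) := ceil_sqrt_eight_mul_le (e := e + 1) (n := n)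
    have hK (n : ℕ) := ceil_sqrt_two_mul_le (e := e) (n := n)
    generalize ⌈(-1 + √(8 * ((e + 1 : ℕ) : ℝ) + 1)) / 2⌉₊ = m at hm ⊢
    generalize ⌈√(2 * (e : ℝ) - 4)⌉₊ = K at hK ⊢
    have hmm := (hm m).1 le_rfl
    have hKK := (hK K).1 le_rfl
    split_ifs with h10 hodd
    · exact edcn_spiderGraph_eq (spiderColorable_four le_rfl le_rfl h₃₄ (by omega)) hge
    -- For an even number of colors the parity bound is stronger than `2 e + 2 ≤ n (n + 1)` if
    -- `n ≥ 6`, and `n = 4` is excluded by `e ≥ 11`.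
    · have h5 : 5 ≤ m := by nlinarith
      refine edcn_spiderGraph_eq (spiderColorable_one_one_one_of_odd hodd h5 (by omega))
        fun n hn => (hm n).2 ?_
      rcases Nat.even_or_odd n with hev | hod
      · have := hle_even n hn hev
        have h4 := hge n hn
        have h6 : 5 ≤ n := by nlinarith
        have h6' : n ≠ 5 := fun h => absurd hev (h ▸ by decide)
        have h6'' : 6 ≤ n := by omega
        nlinarith
      · exact hle_odd n hn hod
    · have h5 : 5 ≤ K := by nlinarith
      refine edcn_spiderGraph_eq ?_ fun n hn => (hK n).2 ?_
      · rcases Nat.even_or_odd K with hev | hod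
        · have h6 : K ≠ 5 := fun h => absurd hev (h ▸ by decide)
          exact spiderColorable_of_even le_rfl le_rfl le_rfl h₃₄ hev (by omega) (by omega)
        · refine spiderColorable_one_one_one_of_odd hod h5 ?_
          rcases h5.eq_or_lt with rfl | h6
          · omega
          · nlinarith
      · rcases Nat.even_or_odd n with hev | hod
        · exact hle_even n hn hev
        · have := hodd_step hodd hod ((hm n).2 (hle_odd n hn hod)) hmm
          omega
  · have hm (n : ℕ) := ceil_sqrt_eight_mul_le (e := e) (n := n)
    have hK (n : ℕ) := ceil_sqrt_two_mul_le (e := e) (n := n)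
    generalize ⌈(-1 + √(8 * (e : ℝ) + 1)) / 2⌉₊ = m at hm ⊢
    generalize ⌈√(2 * (e : ℝ) - 4)⌉₊ = K at hK ⊢
    have hmm := (hm m).1 le_rfl
    have hKK := (hK K).1 le_rfl
    split_ifs with h1 h2 hodd
    · obtain ⟨h10, rfl⟩ := h1
      exact edcn_spiderGraph_eq (spiderColorable_four h₁₂ h₂₃ h₃₄ (by omega)) hge
    · refine edcn_spiderGraph_eq
        (spiderColorable_of_odd h₁ h₁₂ h₃₄ h3 (by decide) le_rfl (by omega)) fun n hn => ?_
      exact hn.lt fun i => by fin_cases i <;> simp <;> omega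
    · have h5 : 5 ≤ m := by nlinarith
      exact edcn_spiderGraph_eq
        (spiderColorable_of_odd h₁ h₁₂ h₃₄ h3 hodd.2 h5 (by omega)) fun n hn => (hm n).2 (hle n hn)
    · have h11 : 11 ≤ e := by omega
      have hodd' : ¬ Odd m := fun h => hodd ⟨h11, h⟩
      have h5 : 5 ≤ K := by nlinarith
      refine edcn_spiderGraph_eq ?_ fun n hn => (hK n).2 ?_
      · rcases Nat.even_or_odd K with hev | hod
        · have h6 : K ≠ 5 := fun h => absurd hev (h ▸ by decide)
          exact spiderColorable_of_even h₁ h₁₂ h₂₃ h₃₄ hev (by omega) (by omega)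
        · exact spiderColorable_of_odd h₁ h₁₂ h₃₄ h3 hod h5 (by nlinarith)
      · rcases Nat.even_or_odd n with hev | hod
        · exact hle_even n hn hev
        · exact hodd_step hodd' hod ((hm n).2 (hle n hn)) hmm
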